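/- Let $k$ be an infinite field, $S=k[x_1,\dots,x_n]$ with its standard grading, and let $2\le e_1\le\dots\le e_n$ be integers. All ideals below are homogeneous and proper. **Definitions.** The depth of an ideal is the largest length of an $S$-regular sequence contained in it. An ideal $I$ *minimally contains an $(a_1,\dots,a_r)$-regular sequence of forms* if $I$ has depth $r$, the minimum degree of the nonzero forms in $I$ is $a_1$, and for each $2\le i\le r$, $a_i$ is the smallest degree such that $I$ contains an $S$-regular sequence of forms of degrees $a_1,\dots,a_i$. A *complete intersection (CI) ideal* is an ideal generated by an $S$-regular sequence of forms $f_1,\dots,f_r$; if $\deg f_1\le\dots\le\deg f_r$, its *type* is $(\deg f_1,\dots,\deg f_r)$. Two ideals $I,I'$ of height $r$ are *directly linked by* a CI ideal $J$ of height $r$ if $J\subseteq I\cap I'$, $I=J:I'$ and $I'=J:I$; the link $J$ of $I$ to $I'$ is *minimal* if $I$ minimally contains an $(a_1,\dots,a_r)$-regular sequence of forms and $J$ has type $(a_1,\dots,a_r)$. An ideal $I$ of height $r$ is a *sequentially bounded licci ideal that admits a minimal first link* if there are $s\ge 1$, ideals $I=I_0,I_1,\dots,I_s$ of height $r$ with $I_s$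 a CI ideal, and CI ideals $J_1,\dots,J_s$ of height $r$ such that $I_{i-1}$ and $I_i$ are directly linked by $J_i$ for $1\le i\le s$, the types $\mathbf a^{(i)}$ of $J_i$ satisfy $\mathbf a^{(1)}\ge\dots\ge\mathbf a^{(s)}$ entrywise, and $J_1$ is a minimal link of $I_0$ to $I_1$. A *monomial ideal* is an ideal generated by monomials. **Theorem.** If $I\subsetneq S$ is a sequentially bounded licci ideal that admits a minimal first link and minimally contains an $(e_1,\dots,e_n)$-regular sequence of forms, then there exists a monomial ideal $J\subsetneq S$ containing $x_1^{e_1},\dots,x_n^{e_n}$ such that $I$ and $J$ have the same Hilbert function, i.e. $\dim_k (S/I)_d=\dim_k (S/J)_d$ for all $d\ge 0$. -/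

import Mathlib

open MvPolynomial

noncomputable section

namespace Liaison

attribute [local instance] MvPolynomial.gradedAlgebra

variable {k : Type*} [Field k] {n : ℕ}

/-- The depth of an ideal `I` of `R`: the supremum of the lengths of the `R`-regular sequences
consisting of elements of `I`. -/
def depth {R : Type*} [CommRing R] (I : Ideal R) : ℕ∞ :=
  ⨆ (rs : List R) (_ : RingTheory.Sequence.IsRegular R rs) (_ : ∀ x ∈ rs, x ∈ I),
    (rs.length : ℕ∞)

/-- `I` is homogeneous for the standard grading of `k[x₁, …, xₙ]` and proper. -/
def IsHomogeneousProper (I : Ideal (MvPolynomial (Fin n) k)) : Prop :=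
  I.IsHomogeneous (homogeneousSubmodule (Fin n) k) ∧ I ≠ ⊤

/-- `f₁, …, fᵣ` is a regular sequence of forms of degrees `a₁, …, aᵣ`. (The members of a regular
sequence are nonzero, so that `a i` is the degree of `f i`.) -/
def IsRegularSeqOfForms {r : ℕ} (a : Fin r → ℕ) (f : Fin r → MvPolynomial (Fin n) k) : Prop :=
  (∀ i, (f i).IsHomogeneous (a i)) ∧
    RingTheory.Sequence.IsRegular (MvPolynomial (Fin n) k) (List.ofFn f)

/-- `I` contains a regular sequence of `r` forms of degrees `a₁, …, aᵣ`. -/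
def ContainsRegularSeq {r : ℕ} (I : Ideal (MvPolynomial (Fin n) k)) (a : Fin r → ℕ) : Prop :=
  ∃ f : Fin r → MvPolynomial (Fin n) k, IsRegularSeqOfForms a f ∧ ∀ i, f i ∈ I

/-- The proper ideal `I` minimally contains an `(a₁, …, aᵣ)`-regular sequence of forms: `I` has
depth `r`, the minimum degree of the nonzero forms in `I` is `a₁`, and for `2 ≤ i ≤ r` the integer
`aᵢ` is the smallest `d` such that `I` contains a regular sequence of forms of degrees
`a₁, …, aᵢ₋₁, d`. The index `i : Fin r` below is zero-based. -/
def MinimallyContainsRegularSeq {r : ℕ} (I : Ideal (MvPolynomial (Fin n) k))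
    (a : Fin r → ℕ) : Prop :=
  I ≠ ⊤ ∧ depth I = r ∧
    (∀ h : 0 < r,
      IsLeast {d : ℕ | ∃ f ∈ I, f ≠ 0 ∧ f.IsHomogeneous d} (a ⟨0, h⟩)) ∧
    ∀ i : Fin r, 0 < (i : ℕ) →
      IsLeast {d : ℕ | ContainsRegularSeq I
        (Fin.snoc (fun j : Fin (i : ℕ) => a ⟨j, j.isLt.trans i.isLt⟩) d : Fin ((i : ℕ) + 1) → ℕ)}
        (a i)

/-- `J` is a complete intersection ideal of type `(a₁ ≤ … ≤ aᵣ)`. -/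
def IsCIOfType {r : ℕ} (a : Fin r → ℕ) (J : Ideal (MvPolynomial (Fin n) k)) : Prop :=
  Monotone a ∧ ∃ f : Fin r → MvPolynomial (Fin n) k,
    IsRegularSeqOfForms a f ∧ J = Ideal.span (Set.range f)

/-- `J` is a complete intersection ideal: it is generated by a regular sequence of forms. -/
def IsCI (J : Ideal (MvPolynomial (Fin n) k)) : Prop :=
  ∃ (r : ℕ) (a : Fin r → ℕ) (f : Fin r → MvPolynomial (Fin n) k),
    IsRegularSeqOfForms a f ∧ J = Ideal.span (Set.range f)

/-- The homogeneous proper ideals `I`, `I'` of height `r` are directly linked by the complete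
intersection ideal `J` of height `r`: `J ⊆ I ∩ I'`, `I = J : I'` and `I' = J : I`. -/
structure DirectlyLinkedBy (r : ℕ) (J I I' : Ideal (MvPolynomial (Fin n) k)) : Prop where
  left : IsHomogeneousProper I
  right : IsHomogeneousProper I'
  height_left : I.height = r
  height_right : I'.height = r
  isCI : IsCI J
  height_link : J.height = r
  le : J ≤ I ⊓ I'
  left_eq : I = J.colon (I' : Set (MvPolynomial (Fin n) k))
  right_eq : I' = J.colon (I : Set (MvPolynomial (Fin n) k))

/-- `I = I₀ ∼ I₁ ∼ ⋯ ∼ Iₛ` (`s ≥ 1`) is a sequence of links by `J₁, …, Jₛ` (with zero-based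
indices here) between ideals of height `r`, it ends in a complete intersection ideal `Iₛ`, and
the types `a⁽¹⁾, …, a⁽ˢ⁾` of the links satisfy `a⁽¹⁾ ≥ ⋯ ≥ a⁽ˢ⁾` entrywise. -/
structure IsBoundedLinkSequence (I : Ideal (MvPolynomial (Fin n) k)) (r s : ℕ)
    (L : Fin (s + 1) → Ideal (MvPolynomial (Fin n) k))
    (J : Fin s → Ideal (MvPolynomial (Fin n) k)) (a : Fin s → Fin r → ℕ) : Prop where
  pos : 0 < s
  start : L 0 = I
  linked : ∀ i : Fin s, DirectlyLinkedBy r (J i) (L i.castSucc) (L i.succ)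
  last : IsCI (L (Fin.last s))
  type : ∀ i : Fin s, IsCIOfType (a i) (J i)
  antitone : Antitone a

/-- `J` is a minimal link of `I` (with `I'`): for some `(b₁, …, bᵣ)`, the ideal `I` minimally
contains a `(b₁, …, bᵣ)`-regular sequence of forms, and `I`, `I'` are directly linked by `J`, which
is a complete intersection ideal of type `(b₁, …, bᵣ)`. -/
def IsMinimalLink (r : ℕ) (J I I' : Ideal (MvPolynomial (Fin n) k)) : Prop :=
  DirectlyLinkedBy r J I I' ∧
    ∃ b : Fin r → ℕ, MinimallyContainsRegularSeq I b ∧ IsCIOfType b J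

/-- `I` is a sequentially bounded licci ideal that admits a minimal first link: some sequence of
links from `I` to a complete intersection ideal has weakly decreasing types, and its first link is
minimal. -/
def IsSeqBoundedLicciWithMinimalFirstLink (I : Ideal (MvPolynomial (Fin n) k)) : Prop :=
  ∃ (r s : ℕ) (L : Fin (s + 1) → Ideal (MvPolynomial (Fin n) k))
    (J : Fin s → Ideal (MvPolynomial (Fin n) k)) (a : Fin s → Fin r → ℕ)
    (h : IsBoundedLinkSequence I r s L J a),
    IsMinimalLink r (J ⟨0, h.pos⟩) (L (Fin.castSucc ⟨0, h.pos⟩)) (L (Fin.succ ⟨0, h.pos⟩))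

/-- A monomial ideal: an ideal generated by a set of monomials `x^α`. -/
def IsMonomialIdeal (J : Ideal (MvPolynomial (Fin n) k)) : Prop :=
  ∃ A : Set (Fin n →₀ ℕ), J = Ideal.span ((fun α => monomial α (1 : k)) '' A)

/-- The Hilbert function `H(S/I, d) = dim_k (S/I)_d` of the quotient of `S = k[x₁, …, xₙ]` by a
homogeneous ideal `I`; the degree `d` component is the image of the forms of degree `d`. -/
def hilbertFunction (I : Ideal (MvPolynomial (Fin n) k)) (d : ℕ) : ℕ :=
  Module.finrank k
    ((homogeneousSubmodule (Fin n) k d).map (Ideal.Quotient.mkₐ k I).toLinearMap)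

end Liaison

end

/-! Since `I` has depth `n`, the whole link sequence lives in height `n`, where complete
intersections have Artinian Gorenstein quotients. Two facts make Hilbert functions along it
computable. The Hilbert function of a complete intersection depends only on its degrees
(`RegularMod.hilbertFunction_eq`). If `S / J` is Gorenstein with socle degree `σ` and `J ≤ I`, the
pairing `(u, v) ↦ φ (u * v)`, with `φ` a functional detecting `J` in degree `σ`, gives `dim (J :
I)_d + dim I_(σ-d) = dim S_d + dim J_(σ-d)` (`IsGorenstein.gradedDim_colon`). So the Hilbert
function of a link depends only on those of `J` and `I`.

Hence each link can be imitated by monomial ideals, going backwards from the final complete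
intersection. That ideal is replaced by an ideal of powers of variables, and each `Jᵢ` by the ideal
of the powers of exponents `a⁽ⁱ⁾`; colons of monomial ideals are monomial. The replacement is
legitimate only if these powers lie in the current monomial ideal. At the end of the sequence this
is a degree comparison through heights (`IsRegularSeqOfForms.degree_le`); it then persists because
the types decrease along the sequence. Minimality of the first link identifies the exponents
obtained for `I` with `e`. -/

noncomputable section

namespace Liaison

attribute [local instance] MvPolynomial.gradedAlgebra

/-! ### Regular sequences modulo an ideal -/

section General

variable {R : Type*} [CommRing R]

/-- `f` is a nonzerodivisor on `R / Q`. -/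
def NonzerodivisorMod (Q : Ideal R) (f : R) : Prop := ∀ x, f * x ∈ Q → x ∈ Q

/-- The list is a weakly regular sequence on `R / Q`. -/
def RegularMod (Q : Ideal R) : List R → Prop
  | [] => True
  | f :: F => NonzerodivisorMod Q f ∧ RegularMod (Q ⊔ Ideal.span {f}) F

theorem regularMod_append {Q : Ideal R} {F G : List R} :
    RegularMod Q (F ++ G) ↔ RegularMod Q F ∧ RegularMod (Q ⊔ Ideal.ofList F) G := by
  induction F generalizing Q with
  | nil => simp [RegularMod]
  | cons f F ih => simp [RegularMod, ih, and_assoc, sup_assoc]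

theorem regularMod_of_getElem {Q : Ideal R} {F : List R}
    (h : ∀ i (hi : i < F.length), NonzerodivisorMod (Q ⊔ Ideal.ofList (F.take i)) F[i]) :
    RegularMod Q F := by
  induction F generalizing Q with
  | nil => trivial
  | cons f F ih =>
    have h0 := h 0 (by simp)
    rw [List.take_zero, Ideal.ofList_nil, sup_bot_eq] at h0
    refine ⟨h0, ih fun i hi => ?_⟩
    have hs := h (i + 1) (by simpa using hi)
    rw [List.take_succ_cons, Ideal.ofList_cons, ← sup_assoc] at hs
    exact hs

theorem RegularMod.of_isWeaklyRegular {F : List R}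
    (h : RingTheory.Sequence.IsWeaklyRegular R F) : RegularMod (⊥ : Ideal R) F := by
  refine regularMod_of_getElem fun i hi x hx => ?_
  have := h.regular_mod_prev i hi
  rw [isSMulRegular_iff_right_eq_zero_of_smul] at this
  have h2 := this (Submodule.Quotient.mk x)
  rw [← Submodule.Quotient.mk_smul, Submodule.Quotient.mk_eq_zero,
    Submodule.Quotient.mk_eq_zero] at h2
  simpa using h2 (by simpa using hx)

theorem mem_sup_span_singleton {Q : Ideal R} {f x : R} :
    x ∈ Q ⊔ Ideal.span {f} ↔ ∃ q ∈ Q, ∃ y, x = q + f * y := by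
  simp only [Submodule.mem_sup, Ideal.mem_span_singleton']
  constructor
  · rintro ⟨q, hq, _, ⟨y, rfl⟩, rfl⟩
    exact ⟨q, hq, y, by ring⟩
  · rintro ⟨q, hq, y, rfl⟩
    exact ⟨q, hq, _, ⟨y, rfl⟩, by ring⟩

/-- If `a * x = q + b * y`, then `y = q' + a * z` modulo-`a` regularity of `b`, and cancelling `a`
gives `x - b * z ∈ Q`. No grading is needed here. -/
theorem NonzerodivisorMod.swap_right {Q : Ideal R} {a b : R} (ha : NonzerodivisorMod Q a)
    (hab : NonzerodivisorMod (Q ⊔ Ideal.span {a}) b) :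
    NonzerodivisorMod (Q ⊔ Ideal.span {b}) a := by
  intro x hx
  obtain ⟨q, hq, y, hy⟩ := mem_sup_span_singleton.1 hx
  have h1 : b * y ∈ Q ⊔ Ideal.span {a} :=
    mem_sup_span_singleton.2 ⟨-q, neg_mem hq, x, by rw [hy]; ring⟩
  obtain ⟨q', hq', z, hz⟩ := mem_sup_span_singleton.1 (hab y h1)
  have h2 : a * (x - b * z) ∈ Q := by
    have : a * (x - b * z) = q + b * q' := by rw [mul_sub, hy, hz]; ring
    rw [this]
    exact add_mem hq (Q.mul_mem_left _ hq')
  exact mem_sup_span_singleton.2 ⟨_, ha _ h2, z, by ring⟩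

end General

/-! ### Forms, and permuting regular sequences of forms -/

variable {k : Type*} [Field k] {n : ℕ}

local notation "S" => MvPolynomial (Fin n) k

/-- The ideal is homogeneous for the standard grading. -/
abbrev Homog (Q : Ideal (MvPolynomial (Fin n) k)) : Prop :=
  Q.IsHomogeneous (homogeneousSubmodule (Fin n) k)

theorem homogeneousComponent_mul_of_le {f g : S} {p d : ℕ} (hf : f.IsHomogeneous p)
    (h : p ≤ d) : homogeneousComponent d (f * g) = f * homogeneousComponent (d - p) g := by
  simpa only [← decomposition.decompose'_apply] using! DirectSum.coe_decompose_mul_of_left_mem_of_le (homogeneousSubmodule (Fin n) k)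
    (a := f) (b := g) hf h

theorem homogeneousComponent_mul_of_lt {f g : S} {p d : ℕ} (hf : f.IsHomogeneous p)
    (h : d < p) : homogeneousComponent d (f * g) = 0 := by
  simpa only [← decomposition.decompose'_apply] using! DirectSum.coe_decompose_mul_of_left_mem_of_not_le (homogeneousSubmodule (Fin n) k)
    (a := f) (b := g) hf (not_le.2 h)

theorem mem_of_forall_component {Q : Ideal S} {x : S}
    (h : ∀ d, homogeneousComponent d x ∈ Q) : x ∈ Q := by
  rw [← sum_homogeneousComponent x]
  exact sum_mem fun d _ => h d

/-- A form in `Q + (f)` is the sum of a form in `Q` and of a form multiple of `f`. -/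
theorem exists_form_of_mem_sup {Q : Ideal S} (hQ : Homog Q) {f x : S} {p d : ℕ}
    (hf : f.IsHomogeneous p) (hx : x.IsHomogeneous (d + p)) (hxQ : x ∈ Q ⊔ Ideal.span {f}) :
    ∃ q ∈ Q, q.IsHomogeneous (d + p) ∧ ∃ y : S, y.IsHomogeneous d ∧ x = q + f * y := by
  obtain ⟨q, hq, y, rfl⟩ := mem_sup_span_singleton.1 hxQ
  refine ⟨_, homogeneousComponent_mem_of_mem hQ hq (d + p), homogeneousComponent_isHomogeneous _ _,
    _, homogeneousComponent_isHomogeneous d y, ?_⟩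
  have := homogeneousComponent_eq_self hx
  rw [map_add, homogeneousComponent_mul_of_le hf (by omega)] at this
  rw [← this]
  simp

theorem mem_of_mem_sup_of_lt {Q : Ideal S} (hQ : Homog Q) {f x : S} {p d : ℕ}
    (hf : f.IsHomogeneous p) (hx : x.IsHomogeneous d) (h : d < p)
    (hxQ : x ∈ Q ⊔ Ideal.span {f}) : x ∈ Q := by
  obtain ⟨q, hq, y, rfl⟩ := mem_sup_span_singleton.1 hxQ
  have := homogeneousComponent_eq_self hx
  rw [map_add, homogeneousComponent_mul_of_lt hf h, add_zero] at this
  rw [← this]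
  exact homogeneousComponent_mem_of_mem hQ hq d

theorem Homog.sup_span {Q : Ideal S} (hQ : Homog Q) {f : S} {p : ℕ} (hf : f.IsHomogeneous p) :
    Homog (Q ⊔ Ideal.span {f}) :=
  hQ.sup (Ideal.homogeneous_span _ _ (by rintro _ rfl; exact ⟨p, hf⟩))

theorem homog_bot : Homog (⊥ : Ideal S) := Ideal.IsHomogeneous.bot _

theorem homog_ofList {F : List S} {D : List ℕ} (h : List.Forall₂ IsHomogeneous F D) :
    Homog (Ideal.ofList F) := by
  induction h with
  | nil => simpa using homog_bot
  | cons h _ ih =>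
    rw [Ideal.ofList_cons, sup_comm]
    exact Homog.sup_span ih h

/-- A graded Krull intersection argument: a solution of `b * x ∈ Q` lies in `Q + (a ^ N)` for every
`N`, and in degrees below that of `a ^ N` this ideal agrees with `Q`. -/
theorem NonzerodivisorMod.swap_left {Q : Ideal S} (hQ : Homog Q) {a b : S} {p : ℕ}
    (hp : 0 < p) (ha : a.IsHomogeneous p) (haQ : NonzerodivisorMod Q a)
    (hab : NonzerodivisorMod (Q ⊔ Ideal.span {a}) b) : NonzerodivisorMod Q b := by
  have key : ∀ (N : ℕ) (x : S), b * x ∈ Q → x ∈ Q ⊔ Ideal.span {a ^ N} := by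
    intro N
    induction N with
    | zero => intro x _; simp
    | succ N ih =>
      intro x hx
      obtain ⟨q, hq, y, rfl⟩ := mem_sup_span_singleton.1 (hab x (Ideal.mem_sup_left hx))
      have h1 : b * y ∈ Q := by
        apply haQ
        have : a * (b * y) = b * (q + a * y) - b * q := by ring
        rw [this]
        exact sub_mem hx (Q.mul_mem_left _ hq)
      obtain ⟨q', hq', z, rfl⟩ := mem_sup_span_singleton.1 (ih y h1)
      exact mem_sup_span_singleton.2
        ⟨q + a * q', add_mem hq (Q.mul_mem_left _ hq'), z, by ring⟩
  intro x hx
  refine mem_of_forall_component fun d => ?_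
  have h1 := key (d + 1) x hx
  have hpow := ha.pow (d + 1)
  have h2 := homogeneousComponent_mem_of_mem (hQ.sup_span hpow) h1 d
  exact mem_of_mem_sup_of_lt hQ hpow (homogeneousComponent_isHomogeneous _ _)
    (by nlinarith) h2

/-- The last member of a regular sequence of forms can be moved to the front. -/
theorem RegularMod.rotate {F : List S} {D : List ℕ} (hF : List.Forall₂ IsHomogeneous F D)
    (hD : ∀ d ∈ D, 0 < d) {Q : Ideal S} (hQ : Homog Q) {b : S}
    (h : RegularMod Q (F ++ [b])) : RegularMod Q (b :: F) := by
  induction hF generalizing Q with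
  | nil => simpa using h
  | @cons a p F D ha _ ih =>
    have h1 := ih (fun d hd => hD d (by simp [hd])) (hQ.sup_span ha) h.2
    have hb := NonzerodivisorMod.swap_left hQ (hD p (by simp)) ha h.1 h1.1
    refine ⟨hb, h.1.swap_right h1.1, ?_⟩
    have := h1.2
    rwa [sup_right_comm] at this

/-! ### Graded dimensions and Hilbert functions -/

/-- The forms of degree `d` in the ideal `I`. -/
def gradedPart (I : Ideal (MvPolynomial (Fin n) k)) (d : ℕ) :
    Submodule k (MvPolynomial (Fin n) k) :=
  I.restrictScalars k ⊓ homogeneousSubmodule (Fin n) k d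

theorem mem_gradedPart {I : Ideal S} {d : ℕ} {x : S} :
    x ∈ gradedPart I d ↔ x ∈ I ∧ x.IsHomogeneous d := Iff.rfl

instance finite_homogeneousSubmodule (d : ℕ) :
    Module.Finite k (homogeneousSubmodule (Fin n) k d) :=
  Module.Finite.iff_fg.2 (homogeneousSubmodule_fg (σ := Fin n) (R := k) d)

instance finite_gradedPart (I : Ideal S) (d : ℕ) : Module.Finite k (gradedPart I d) :=
  Submodule.finiteDimensional_of_le (inf_le_right : _ ≤ homogeneousSubmodule (Fin n) k d)

theorem gradedPart_top (d : ℕ) :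
    gradedPart (⊤ : Ideal S) d = homogeneousSubmodule (Fin n) k d := by
  ext x
  simp [mem_gradedPart]

/-- The dimension of the degree `d` component of the ideal `I`. -/
def gradedDim (I : Ideal (MvPolynomial (Fin n) k)) (d : ℕ) : ℕ :=
  Module.finrank k (gradedPart I d)

theorem hilbertFunction_add (I : Ideal S) (d : ℕ) :
    hilbertFunction I d + gradedDim I d =
      gradedDim (⊤ : Ideal S) d := by
  let φ := ((Ideal.Quotient.mkₐ k I).toLinearMap).domRestrict (homogeneousSubmodule (Fin n) k d)
  have h := LinearMap.finrank_range_add_finrank_ker φ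
  rw [LinearMap.range_domRestrict] at h
  have h2 : gradedPart I d = (LinearMap.ker φ).map (homogeneousSubmodule (Fin n) k d).subtype := by
    ext x
    simp [mem_gradedPart, φ, Ideal.Quotient.eq_zero_iff_mem, and_comm]
  rw [gradedDim, gradedDim, gradedPart_top, h2, Submodule.finrank_map_subtype_eq]
  exact h

theorem gradedDim_eq_iff {I J : Ideal S} {d : ℕ} :
    gradedDim I d = gradedDim J d ↔
      hilbertFunction I d = hilbertFunction J d := by
  have h1 := hilbertFunction_add I d
  have h2 := hilbertFunction_add J d
  omega

/-- Dimension count for `(Q + (f))_(d+p) = Q_(d+p) + f S_d`, where regularity of `f` makes the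
intersection of the two summands equal to `f Q_d`. -/
theorem gradedDim_sup_span {Q : Ideal S} (hQ : Homog Q) {f : S} {p : ℕ}
    (hf : f.IsHomogeneous p) (hfQ : NonzerodivisorMod Q f) (d : ℕ) :
    gradedDim (Q ⊔ Ideal.span {f}) (d + p) +
      gradedDim Q d = gradedDim Q (d + p) +
        gradedDim (⊤ : Ideal S) d := by
  by_cases hT : Q = ⊤
  · subst hT
    simp [add_comm]
  have hf0 : f ≠ 0 := by
    rintro rfl
    exact hT ((Ideal.eq_top_iff_one _).2 (hfQ 1 (by simp)))
  have hinj : Function.Injective (LinearMap.mulLeft k f) := mul_right_injective₀ hf0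
  have h1 : gradedPart (Q ⊔ Ideal.span {f}) (d + p) = gradedPart Q (d + p) ⊔
      (homogeneousSubmodule (Fin n) k d).map (LinearMap.mulLeft k f) := by
    ext x
    constructor
    · rintro ⟨h1, h2⟩
      obtain ⟨q, hq, hq', y, hy, rfl⟩ := exists_form_of_mem_sup hQ hf h2 h1
      exact Submodule.add_mem_sup ⟨hq, hq'⟩ ⟨y, hy, rfl⟩
    · intro hx
      obtain ⟨q, hq, _, ⟨y, hy, rfl⟩, rfl⟩ := Submodule.mem_sup.1 hx
      refine ⟨mem_sup_span_singleton.2 ⟨q, hq.1, y, rfl⟩, hq.2.add ?_⟩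
      rw [add_comm]
      exact hf.mul hy
  have h2 : gradedPart Q (d + p) ⊓ (homogeneousSubmodule (Fin n) k d).map
      (LinearMap.mulLeft k f) = (gradedPart Q d).map (LinearMap.mulLeft k f) := by
    ext x
    constructor
    · rintro ⟨h1, y, hy, rfl⟩
      exact ⟨y, ⟨hfQ y h1.1, hy⟩, rfl⟩
    · rintro ⟨y, hy, rfl⟩
      refine ⟨⟨Q.mul_mem_left _ hy.1, ?_⟩, y, hy.2, rfl⟩
      rw [add_comm]
      exact hf.mul hy.2
  have h3 := Submodule.finrank_sup_add_finrank_inf_eq (gradedPart Q (d + p))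
    ((homogeneousSubmodule (Fin n) k d).map (LinearMap.mulLeft k f))
  rw [← h1, h2, ← LinearEquiv.finrank_eq (Submodule.equivMapOfInjective _ hinj (gradedPart Q d)),
    ← LinearEquiv.finrank_eq (Submodule.equivMapOfInjective _ hinj
      (homogeneousSubmodule (Fin n) k d))] at h3
  rw [gradedDim, gradedDim, gradedDim, gradedDim, gradedPart_top]
  exact h3

theorem gradedPart_sup_span_of_lt {Q : Ideal S} (hQ : Homog Q) {f : S} {p d : ℕ}
    (hf : f.IsHomogeneous p) (hd : d < p) :
    gradedPart (Q ⊔ Ideal.span {f}) d = gradedPart Q d := by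
  ext x
  exact ⟨fun h => ⟨mem_of_mem_sup_of_lt hQ hf h.2 hd h.1, h.2⟩,
    fun h => ⟨Ideal.mem_sup_left h.1, h.2⟩⟩

theorem RegularMod.gradedDim_eq {F G : List S} {D : List ℕ}
    (hF : List.Forall₂ IsHomogeneous F D) (hG : List.Forall₂ IsHomogeneous G D) {P Q : Ideal S}
    (hP : Homog P) (hQ : Homog Q) (hFP : RegularMod P F) (hGQ : RegularMod Q G)
    (h : ∀ d, gradedDim P d = gradedDim Q d) (d : ℕ) :
    gradedDim (P ⊔ Ideal.ofList F) d =
      gradedDim (Q ⊔ Ideal.ofList G) d := by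
  induction hF generalizing G P Q with
  | nil =>
    cases hG
    simpa using h d
  | @cons f p F D hf _ ih =>
    obtain _ | ⟨hg, hG⟩ := hG
    rw [Ideal.ofList_cons, Ideal.ofList_cons, ← sup_assoc, ← sup_assoc]
    refine ih hG (hP.sup_span hf) (hQ.sup_span hg) hFP.2 hGQ.2 fun d => ?_
    obtain hd | hd := lt_or_ge d p
    · rw [gradedDim, gradedDim, gradedPart_sup_span_of_lt hP hf hd,
        gradedPart_sup_span_of_lt hQ hg hd]
      exact h d
    · obtain ⟨c, rfl⟩ := Nat.exists_eq_add_of_le' hd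
      have h1 := gradedDim_sup_span hP hf hFP.1 c
      have h2 := gradedDim_sup_span hQ hg hGQ.1 c
      rw [h, h] at h1
      omega

/-- Regular sequences of forms of the same degrees define the same Hilbert function. -/
theorem RegularMod.hilbertFunction_eq {F G : List S} {D : List ℕ}
    (hF : List.Forall₂ IsHomogeneous F D) (hG : List.Forall₂ IsHomogeneous G D)
    (hFP : RegularMod ⊥ F) (hGQ : RegularMod ⊥ G) :
    hilbertFunction (Ideal.ofList F) = hilbertFunction (Ideal.ofList G) := by
  funext d
  rw [← gradedDim_eq_iff]
  simpa using RegularMod.gradedDim_eq hF hG homog_bot homog_bot hFP hGQ (fun _ => rfl) d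

/-! ### The socle of a complete intersection -/

theorem nonzerodivisorMod_iff_isSMulRegular {R : Type*} [CommRing R] {Q : Ideal R} {x : R} :
    NonzerodivisorMod Q x ↔ IsSMulRegular (R ⧸ Q) x := by
  rw [isSMulRegular_iff_right_eq_zero_of_smul]
  constructor
  · intro h y hy
    obtain ⟨y, rfl⟩ := Submodule.Quotient.mk_surjective _ y
    rw [← Submodule.Quotient.mk_smul, Submodule.Quotient.mk_eq_zero] at hy
    exact (Submodule.Quotient.mk_eq_zero _).2 (h y hy)
  · intro h y hy
    have := h (Submodule.Quotient.mk y)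
    rw [← Submodule.Quotient.mk_smul, Submodule.Quotient.mk_eq_zero,
      Submodule.Quotient.mk_eq_zero] at this
    exact this hy

theorem mem_span_X_of_isHomogeneous {f : S} {p : ℕ} (hp : 0 < p) (hf : f.IsHomogeneous p) :
    f ∈ Ideal.span (Set.range (X : Fin n → S)) := by
  have : f ∈ idealOfVars (Fin n) k ^ 1 := by
    rw [mem_pow_idealOfVars_iff]
    intro x hx
    have := hf.coeff_eq_zero (d := x)
    rw [mem_support_iff] at hx
    by_contra h
    exact hx (this (by omega))
  rwa [pow_one] at this

/-- The socle of `k[x₁, …, xₙ] / Q` is concentrated in degree `e`. -/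
def SocleConcentrated (Q : Ideal (MvPolynomial (Fin n) k)) (e : ℕ) : Prop :=
  ∀ (d : ℕ) (u : MvPolynomial (Fin n) k), d ≠ e → u.IsHomogeneous d → (∀ i, X i * u ∈ Q) → u ∈ Q

/-- The socles modulo `Q + (f)` and `Q + (g)` correspond: a socle element `v` of the second
satisfies `v * f = q₀ + g * u`, and `u` is a socle element of the first, of degree shifted by `p -
q`. -/
theorem SocleConcentrated.exchange {Q : Ideal S} (hQ : Homog Q) {f g : S} {p q : ℕ} (hp : 0 < p)
    (hf : f.IsHomogeneous p) (hg : g.IsHomogeneous q) (hfQ : NonzerodivisorMod Q f)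
    (hgQ : NonzerodivisorMod Q g) {e e' : ℕ} (he : e' + p = e + q)
    (h : SocleConcentrated (Q ⊔ Ideal.span {f}) e) :
    SocleConcentrated (Q ⊔ Ideal.span {g}) e' := by
  intro d v hd hv hX
  have hfv : v * f ∈ Q ⊔ Ideal.span {g} := by
    have : f ∈ (Q ⊔ Ideal.span {g}).colon (Ideal.span {v} : Ideal S) := by
      refine Ideal.span_le.2 ?_ (mem_span_X_of_isHomogeneous hp hf)
      rintro _ ⟨i, rfl⟩
      rw [SetLike.mem_coe, Submodule.mem_colon]
      intro s hs
      obtain ⟨t, rfl⟩ := Ideal.mem_span_singleton'.1 hs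
      rw [smul_eq_mul, mul_left_comm]
      exact Ideal.mul_mem_left _ _ (hX i)
    rw [Submodule.mem_colon] at this
    simpa [mul_comm] using this v (Ideal.mem_span_singleton_self v)
  have hvf := hv.mul hf
  obtain hlt | hle := lt_or_ge (d + p) q
  · have h1 := mem_of_mem_sup_of_lt hQ hg hvf hlt hfv
    rw [mul_comm] at h1
    exact Ideal.mem_sup_left (hfQ v h1)
  obtain ⟨c, hc⟩ := Nat.exists_eq_add_of_le' hle
  rw [hc] at hvf
  obtain ⟨q₀, hq₀, -, u, hu, huv⟩ := exists_form_of_mem_sup hQ hg hvf hfv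
  have hu' : u ∈ Q ⊔ Ideal.span {f} := by
    refine h c u (by omega) hu fun i => ?_
    obtain ⟨q₁, hq₁, w, hw⟩ := mem_sup_span_singleton.1 (hX i)
    have h1 : g * (X i * u - f * w) ∈ Q := by
      have : g * (X i * u - f * w) = f * q₁ - X i * q₀ := by
        linear_combination f * hw - X i * huv
      rw [this]
      exact sub_mem (Q.mul_mem_left _ hq₁) (Q.mul_mem_left _ hq₀)
    exact mem_sup_span_singleton.2 ⟨_, hgQ _ h1, w, by ring⟩
  obtain ⟨q₂, hq₂, z, hz⟩ := mem_sup_span_singleton.1 hu'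
  have h2 : f * (v - g * z) ∈ Q := by
    have : f * (v - g * z) = q₀ + g * q₂ := by
      linear_combination huv + g * hz
    rw [this]
    exact add_mem hq₀ (Q.mul_mem_left _ hq₂)
  exact mem_sup_span_singleton.2 ⟨_, hfQ _ h2, z, by ring⟩

/-- Over an infinite field, if some form of positive degree is a nonzerodivisor modulo `Q`, then
some linear form is. -/
theorem exists_linear_nonzerodivisorMod [Infinite k] {Q : Ideal S} {f : S} {p : ℕ} (hp : 0 < p)
    (hf : f.IsHomogeneous p) (hfQ : NonzerodivisorMod Q f) :
    ∃ l : S, l.IsHomogeneous 1 ∧ NonzerodivisorMod Q l := by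
  have hset := biUnion_associatedPrimes_eq_compl_regular S (S ⧸ Q)
  let V := homogeneousSubmodule (Fin n) k 1
  -- The linear forms in each associated prime form a proper subspace, as `f` would otherwise lie in
  -- the prime. Finitely many proper subspaces cannot cover the space over an infinite field.
  let T : Ideal S → Submodule k V := fun P => (P.restrictScalars k).comap V.subtype
  have hfin : (T '' associatedPrimes S (S ⧸ Q)).Finite :=
    (associatedPrimes.finite S (S ⧸ Q)).image T
  have htop : ⊤ ∉ T '' associatedPrimes S (S ⧸ Q) := by
    rintro ⟨P, hP, hPT⟩
    have hXP : ∀ i, X i ∈ P := by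
      intro i
      have : (⟨X i, isHomogeneous_X _ _⟩ : V) ∈ T P := by rw [hPT]; trivial
      exact this
    have hfP : f ∈ P := by
      refine Ideal.span_le.2 ?_ (mem_span_X_of_isHomogeneous hp hf)
      rintro _ ⟨i, rfl⟩
      exact hXP i
    have : f ∈ ⋃ P ∈ associatedPrimes S (S ⧸ Q), (P : Set S) := Set.mem_biUnion hP hfP
    rw [hset] at this
    exact this (nonzerodivisorMod_iff_isSMulRegular.1 hfQ)
  have hne := Subspace.biUnion_ne_univ_of_top_notMem (s := hfin.toFinset) (by simpa using htop)
  obtain ⟨⟨l, hl⟩, hl'⟩ := (Set.ne_univ_iff_exists_notMem _).1 hne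
  refine ⟨l, hl, nonzerodivisorMod_iff_isSMulRegular.2 ?_⟩
  by_contra hreg
  have : l ∈ ⋃ P ∈ associatedPrimes S (S ⧸ Q), (P : Set S) := by
    rw [hset]
    exact hreg
  obtain ⟨P, hP, hlP⟩ := Set.mem_iUnion₂.1 this
  refine hl' (Set.mem_iUnion₂.2 ⟨T P, ?_, hlP⟩)
  simpa using ⟨P, hP, rfl⟩

/-- The powers `x_{ρ i} ^ {a i}` of distinct variables form a regular sequence. -/
theorem regularMod_X_pow (ρ : Equiv.Perm (Fin n)) (a : Fin n → ℕ) :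
    RegularMod (⊥ : Ideal S) (List.ofFn fun i => X (ρ i) ^ a i) := by
  refine regularMod_of_getElem fun i hi x hx => ?_
  rw [List.length_ofFn] at hi
  have hspan : (Ideal.ofList ((List.ofFn fun i => (X (ρ i) ^ a i : S)).take i)) =
      Ideal.span ((fun s => monomial s (1 : k)) ''
        ((fun j => Finsupp.single (ρ j) (a j)) '' {j : Fin n | j < i})) := by
    refine congrArg Ideal.span (Set.ext fun y => ?_)
    simp only [Set.mem_ofPred_eq, Set.image_image, Set.mem_image, List.mem_take_iff_getElem,
      List.length_ofFn, List.getElem_ofFn, X_pow_eq_monomial]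
    constructor
    · rintro ⟨j, hj, rfl⟩
      exact ⟨⟨j, by omega⟩, by simp; omega, rfl⟩
    · rintro ⟨j, hj, rfl⟩
      exact ⟨j, by omega, rfl⟩
  rw [bot_sup_eq, hspan, mem_ideal_span_monomial_image] at hx ⊢
  intro m hm
  rw [List.getElem_ofFn, X_pow_eq_monomial] at hx
  have hm' : Finsupp.single (ρ ⟨i, hi⟩) (a ⟨i, hi⟩) + m ∈
      (monomial (Finsupp.single (ρ ⟨i, hi⟩) (a ⟨i, hi⟩)) (1 : k) * x).support := by
    rw [mem_support_iff] at hm ⊢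
    rwa [coeff_monomial_mul, one_mul]
  obtain ⟨_, ⟨j, hj, rfl⟩, hle⟩ := hx _ hm'
  refine ⟨_, ⟨j, hj, rfl⟩, ?_⟩
  rw [Finsupp.single_le_iff] at hle ⊢
  have hne : ρ ⟨i, hi⟩ ≠ ρ j := fun h => by
    have := ρ.injective h
    subst this
    simp at hj
  simpa [Finsupp.single_apply, hne] using hle

theorem forall₂_isHomogeneous_ofFn {r : ℕ} {f : Fin r → S} {a : Fin r → ℕ}
    (h : ∀ i, (f i).IsHomogeneous (a i)) :
    List.Forall₂ IsHomogeneous (List.ofFn f) (List.ofFn a) := by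
  rw [List.forall₂_iff_get]
  exact ⟨by simp, fun i h1 h2 => by simpa using h _⟩

theorem ofList_ofFn {R : Type*} [CommRing R] {r : ℕ} (f : Fin r → R) :
    Ideal.ofList (List.ofFn f) = Ideal.span (Set.range f) := by
  exact congrArg Ideal.span (Set.ext fun x => by simp [List.mem_ofFn])

/-- The ideal has the Hilbert function of `(x₁, …, xₙ)`, hence contains all linear forms. -/
theorem X_mem_ofList_of_regularMod {L : List S} (hL : ∀ l ∈ L, l.IsHomogeneous 1)
    (hlen : L.length = n) (hreg : RegularMod ⊥ L) (i : Fin n) : X i ∈ Ideal.ofList L := by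
  have h1 : List.Forall₂ IsHomogeneous L (List.ofFn fun _ : Fin n => 1) := by
    rw [List.forall₂_iff_get]
    refine ⟨by simpa using hlen, fun i h1 h2 => ?_⟩
    simpa using hL _ (List.getElem_mem h1)
  have h2 : List.Forall₂ IsHomogeneous (List.ofFn fun i : Fin n => (X i : S) ^ 1)
      (List.ofFn fun _ : Fin n => 1) :=
    forall₂_isHomogeneous_ofFn fun i => isHomogeneous_X_pow i 1
  have h3 := RegularMod.hilbertFunction_eq h1 h2 hreg (regularMod_X_pow (Equiv.refl _) fun _ => 1)
  have h4 := (gradedDim_eq_iff (d := 1)).2 (congrFun h3 1)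
  have h5 : gradedPart (Ideal.ofList (List.ofFn fun i : Fin n => (X i : S) ^ 1)) 1 =
      gradedPart ⊤ 1 := by
    refine le_antisymm (fun x hx => ⟨trivial, hx.2⟩) fun x hx => ⟨?_, hx.2⟩
    rw [ofList_ofFn]
    simpa using mem_span_X_of_isHomogeneous one_pos hx.2
  have h6 : gradedPart (Ideal.ofList L) 1 = gradedPart ⊤ 1 := by
    refine Submodule.eq_of_le_of_finrank_eq (fun x hx => ⟨trivial, hx.2⟩) ?_
    rw [← h5]
    exact h4
  have : (X i : S) ∈ gradedPart (Ideal.ofList L) 1 := by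
    rw [h6]
    exact ⟨trivial, isHomogeneous_X _ _⟩
  exact this.1

/-- Each form of `F` is exchanged for a linear form, lowering the socle degree by its degree minus
one, until only linear forms remain and the ideal is `(x₁, …, xₙ)`, with socle in degree `0`. -/
theorem socleConcentrated_append [Infinite k] {F : List S} {D : List ℕ}
    (hF : List.Forall₂ IsHomogeneous F D) (hD : ∀ d ∈ D, 0 < d) {L : List S}
    (hL : ∀ l ∈ L, l.IsHomogeneous 1) (hlen : L.length + F.length = n)
    (hreg : RegularMod ⊥ (L ++ F)) {e : ℕ} (he : e + F.length = D.sum) :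
    SocleConcentrated (Ideal.ofList (L ++ F)) e := by
  induction F using List.reverseRecOn generalizing D L e with
  | nil =>
    cases hF
    intro d u hd hu _
    rw [List.append_nil] at hreg ⊢
    have h0 : 0 < d := by simp at he; omega
    refine Ideal.span_le.2 ?_ (mem_span_X_of_isHomogeneous h0 hu)
    rintro _ ⟨i, rfl⟩
    exact X_mem_ofList_of_regularMod hL (by simpa using hlen) hreg i
  | append_singleton F f ih =>
    have hFl := hF.length_eq
    obtain rfl | ⟨D, q, rfl⟩ := D.eq_nil_or_concat
    · simp at hFl
    simp only [List.concat_eq_append, List.length_append, List.length_singleton,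
      Nat.add_right_cancel_iff, List.sum_append, List.sum_singleton] at hFl he hlen hF hD
    obtain ⟨hF', hf⟩ : List.Forall₂ IsHomogeneous F D ∧ f.IsHomogeneous q := by
      rw [List.forall₂_iff_get] at hF ⊢
      obtain ⟨h1, h2⟩ := hF
      refine ⟨⟨hFl, fun i h3 h4 => ?_⟩, ?_⟩
      · simpa [List.getElem_append_left h3, List.getElem_append_left h4] using
          h2 i (by simp; omega) (by simp; omega)
      · simpa [hFl] using h2 F.length (by simp) (by simp [hFl])
    have hq : 0 < q := hD q (by simp)
    have hD' : ∀ d ∈ D, 0 < d := fun d hd => hD d (by simp [hd])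
    have hLF : List.Forall₂ IsHomogeneous (L ++ F) (L.map (fun _ => 1) ++ D) := by
      refine List.rel_append ?_ hF'
      clear ih hreg hlen
      induction L with
      | nil => simp
      | cons l L ih => exact .cons (hL l (by simp)) (ih fun x hx => hL x (by simp [hx]))
    have hLD : ∀ d ∈ L.map (fun _ => 1) ++ D, 0 < d := by
      intro d hd
      simp only [List.mem_append, List.mem_map] at hd
      obtain ⟨_, _, rfl⟩ | hd := hd
      exacts [one_pos, hD' d hd]
    rw [← List.append_assoc, regularMod_append, bot_sup_eq] at hreg
    have hfQ : NonzerodivisorMod (Ideal.ofList (L ++ F)) f := hreg.2.1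
    obtain ⟨l, hl, hlQ⟩ := exists_linear_nonzerodivisorMod hq hf hfQ
    have hreg' : RegularMod ⊥ (L ++ F ++ [l]) := by
      rw [regularMod_append, bot_sup_eq]
      exact ⟨hreg.1, hlQ, trivial⟩
    -- The new linear form must join `L` at the front for the induction hypothesis to apply.
    have hrot : RegularMod ⊥ (l :: L ++ F) := RegularMod.rotate hLF hLD homog_bot hreg'
    have hsum : F.length ≤ D.sum := by
      rw [hFl]
      clear * - hD'
      induction D with
      | nil => simp
      | cons d D ih =>
        have := hD' d (by simp)
        have := ih fun x hx => hD' x (by simp [hx])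
        simp only [List.length_cons, List.sum_cons]
        omega
    have hIH := ih (e := D.sum - F.length) hF' hD' (L := l :: L) (by simpa [hl] using hL)
      (by simp; omega) hrot (by omega)
    rw [List.cons_append, Ideal.ofList_cons, sup_comm] at hIH
    rw [← List.append_assoc, Ideal.ofList_append, Ideal.ofList_singleton]
    exact hIH.exchange (homog_ofList hLF) one_pos hl hf hlQ hfQ (by omega)

/-! ### Heights and comparison of degrees -/

section Height

variable {R : Type*} [CommRing R]

/-- A nonzerodivisor modulo `Q` avoids every minimal prime of `Q`, so a prime minimal over `Q + (f)`
strictly contains one of them. -/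
theorem NonzerodivisorMod.height_add_one_le {Q : Ideal R} {f : R} (h : NonzerodivisorMod Q f) :
    Q.height + 1 ≤ (Q ⊔ Ideal.span {f}).height := by
  rw [(Q ⊔ Ideal.span {f}).height_eq_inf_minimalPrimes]
  refine le_iInf₂ fun P hP => ?_
  have hPp : P.IsPrime := hP.1.1
  obtain ⟨P', hP', hle⟩ := Ideal.exists_minimalPrimes_le (le_sup_left.trans hP.1.2)
  have hPp' : P'.IsPrime := hP'.1.1
  have hfP : f ∈ P := hP.1.2 (Ideal.mem_sup_right (Ideal.mem_span_singleton_self f))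
  have hfP' : f ∉ P' :=
    (nonzerodivisorMod_iff_isSMulRegular.1 h).notMem_of_mem_minimalPrimes
      (by rwa [Ideal.annihilator_quotient])
  have hlt : P' < P := lt_of_le_of_ne hle fun h => hfP' (h ▸ hfP)
  exact (add_le_add_left (Ideal.height_mono hP'.1.2) 1).trans
    (Ideal.height_add_one_le_of_lt_of_isPrime hlt)

theorem RegularMod.height_add_length_le {Q : Ideal R} {F : List R} (h : RegularMod Q F) :
    Q.height + F.length ≤ (Q ⊔ Ideal.ofList F).height := by
  induction F generalizing Q with
  | nil => simp
  | cons f F ih =>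
    have h1 := ih h.2
    rw [sup_assoc, ← Ideal.ofList_cons] at h1
    refine le_trans ?_ h1
    rw [List.length_cons, Nat.cast_add, Nat.cast_one, add_comm (F.length : ℕ∞), ← add_assoc]
    gcongr
    exact h.1.height_add_one_le

theorem RegularMod.length_le_height {F : List R} (h : RegularMod ⊥ F) :
    F.length ≤ (Ideal.ofList F).height := by
  have := h.height_add_length_le
  rw [bot_sup_eq] at this
  exact le_trans (by simp) this

theorem height_span_image_le [IsNoetherianRing R] {ι : Type*} {T : Set ι} (hT : T.Finite) (g : ι → R)
    (h : Ideal.span (g '' T) ≠ ⊤) : (Ideal.span (g '' T)).height ≤ T.ncard := by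
  refine (Ideal.height_le_spanFinrank _ h).trans ?_
  exact_mod_cast (Submodule.spanFinrank_span_le_ncard_of_finite (hT.image g)).trans
    (Set.ncard_image_le hT)

theorem RegularMod.sup_eq_top_of_zero_mem {Q : Ideal R} {F : List R}
    (h : RegularMod Q F) (h0 : 0 ∈ F) : Q ⊔ Ideal.ofList F = ⊤ := by
  induction F generalizing Q with
  | nil => simp at h0
  | cons f F ih =>
    obtain rfl | h0 := List.mem_cons.1 h0
    · rw [(Ideal.eq_top_iff_one Q).2 (h.1 1 (by simp)), top_sup_eq]
    · rw [Ideal.ofList_cons, ← sup_assoc]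
      exact ih h.2 h0

end Height

theorem mem_span_of_degree_le {ι : Type*} [Fintype ι] {g : ι → S} {c : ι → ℕ}
    (hg : ∀ i, (g i).IsHomogeneous (c i)) {x : S} {d : ℕ} (hx : x.IsHomogeneous d)
    (h : x ∈ Ideal.span (Set.range g)) : x ∈ Ideal.span (g '' {i | c i ≤ d}) := by
  obtain ⟨y, rfl⟩ := Ideal.mem_span_range_iff_exists_fun.1 h
  rw [← homogeneousComponent_eq_self hx, map_sum]
  refine sum_mem fun i _ => ?_
  rw [mul_comm]
  by_cases hi : c i ≤ d
  · rw [homogeneousComponent_mul_of_le (hg i) hi]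
    exact Ideal.mul_mem_right _ _ (Ideal.subset_span ⟨i, hi, rfl⟩)
  · rw [homogeneousComponent_mul_of_lt (hg i) (not_le.1 hi)]
    exact zero_mem _

theorem IsRegularSeqOfForms.regularMod {r : ℕ} {a : Fin r → ℕ} {f : Fin r → S}
    (h : IsRegularSeqOfForms a f) : RegularMod ⊥ (List.ofFn f) :=
  RegularMod.of_isWeaklyRegular h.2.toIsWeaklyRegular

theorem IsRegularSeqOfForms.span_ne_top {r : ℕ} {a : Fin r → ℕ} {f : Fin r → S}
    (h : IsRegularSeqOfForms a f) : Ideal.span (Set.range f) ≠ ⊤ := by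
  have := h.2.top_ne_smul
  rw [ofList_ofFn] at this
  simpa using this.symm

theorem IsRegularSeqOfForms.degree_pos {r : ℕ} {a : Fin r → ℕ} {f : Fin r → S}
    (h : IsRegularSeqOfForms a f) (i : Fin r) : 0 < a i := by
  by_contra ha
  have hmem : f i ∈ Ideal.span (Set.range f) := Ideal.subset_span ⟨i, rfl⟩
  have hC : f i = C (coeff 0 (f i)) := by
    rw [← homogeneousComponent_zero]
    refine (homogeneousComponent_eq_self ?_).symm
    have := h.1 i
    rwa [show a i = 0 by omega] at this
  by_cases h0 : coeff 0 (f i) = 0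
  · rw [h0, C_0] at hC
    have := h.regularMod.sup_eq_top_of_zero_mem (by rw [List.mem_ofFn]; exact ⟨i, hC⟩)
    rw [bot_sup_eq, ofList_ofFn] at this
    exact h.span_ne_top this
  · rw [hC] at hmem
    exact h.span_ne_top (Ideal.eq_top_of_isUnit_mem _ hmem ((Ne.isUnit h0).map C))

theorem IsRegularSeqOfForms.height_eq {r : ℕ} {a : Fin r → ℕ} {f : Fin r → S}
    (h : IsRegularSeqOfForms a f) : (Ideal.span (Set.range f)).height = r := by
  refine le_antisymm ?_ ?_
  · have hT := h.span_ne_top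
    rw [← Set.image_univ] at hT ⊢
    simpa using height_span_image_le Set.finite_univ f hT
  · have := h.regularMod.length_le_height
    rwa [ofList_ofFn, List.length_ofFn] at this

/-- If the ideal of a regular sequence of forms is contained in the ideal generated by as many
forms, then its sorted degrees are entrywise larger. -/
theorem IsRegularSeqOfForms.degree_le {r : ℕ} {a c : Fin r → ℕ} {f g : Fin r → S}
    (hf : IsRegularSeqOfForms a f) (hg : ∀ i, (g i).IsHomogeneous (c i))
    (hgT : Ideal.span (Set.range g) ≠ ⊤) (ha : Monotone a) (hc : Monotone c)
    (h : Ideal.span (Set.range f) ≤ Ideal.span (Set.range g)) : c ≤ a := by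
  intro i
  by_contra! hlt
  -- If `a i < c i`, then by degree the first `i + 1` members of `f` involve only the `g j` with `j
  -- < i`: an ideal of height at least `i + 1` inside one with `i` generators, against Krull's
  -- height theorem.
  have hle : Ideal.ofList ((List.ofFn f).take (i + 1)) ≤ Ideal.span (g '' {j | j < i}) := by
    refine Ideal.span_le.2 fun x hx => ?_
    obtain ⟨j, hj, rfl⟩ := List.mem_take_iff_getElem.1 hx
    simp only [List.length_ofFn, List.getElem_ofFn] at hj ⊢
    have hj' : (⟨j, by omega⟩ : Fin r) ≤ i := by
      rw [Fin.le_def]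
      change j ≤ i
      omega
    refine Ideal.span_mono (Set.image_mono ?_)
      (mem_span_of_degree_le hg (hf.1 _) (h (Ideal.subset_span ⟨⟨j, by omega⟩, rfl⟩)))
    intro l hl
    by_contra hli
    exact absurd ((hc (not_lt.1 hli)).trans (le_trans hl (ha hj'))) (not_le.2 hlt)
  have hreg : RegularMod ⊥ ((List.ofFn f).take (i + 1)) := by
    have := hf.regularMod
    rw [← List.take_append_drop (i + 1) (List.ofFn f), regularMod_append] at this
    exact this.1
  have h1 := hreg.length_le_height.trans (Ideal.height_mono hle)
  have hne : Ideal.span (g '' {j | j < i}) ≠ ⊤ := fun hT =>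
    hgT (top_le_iff.1 (hT ▸ Ideal.span_mono (Set.image_subset_range _ _)))
  have h2 := h1.trans (height_span_image_le (Set.toFinite _) g hne)
  have hcard : {j : Fin r | j < i}.ncard = i := by
    have : {j : Fin r | j < i} = (Finset.Iio i : Set (Fin r)) := by ext; simp
    rw [this, Set.ncard_coe_finset, Fin.card_Iio]
  rw [hcard, List.length_take, List.length_ofFn, min_eq_left i.isLt] at h2
  have : (i : ℕ) + 1 ≤ i := by exact_mod_cast h2
  omega

theorem MinimallyContainsRegularSeq.unique {r : ℕ} {I : Ideal S} {a b : Fin r → ℕ}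
    (ha : MinimallyContainsRegularSeq I a) (hb : MinimallyContainsRegularSeq I b) : a = b := by
  have key : ∀ (m : ℕ) (hm : m < r), a ⟨m, hm⟩ = b ⟨m, hm⟩ := by
    intro m
    induction m using Nat.strong_induction_on with
    | _ m ih =>
      intro hm
      obtain rfl | h0 := Nat.eq_zero_or_pos m
      · exact (ha.2.2.1 hm).unique (hb.2.2.1 hm)
      · have h1 := ha.2.2.2 ⟨m, hm⟩ h0
        have h2 := hb.2.2.2 ⟨m, hm⟩ h0
        have h3 : (fun j : Fin m => a ⟨j, j.isLt.trans hm⟩) =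
            fun j : Fin m => b ⟨j, j.isLt.trans hm⟩ :=
          funext fun j => ih j j.isLt _
        simp only [h3] at h1
        exact h1.unique h2
  exact funext fun i => key i i.isLt

/-! ### Ideals of powers of the variables -/

/-- The ideal of the powers `xᵢ ^ aᵢ`. -/
def powerIdeal (k : Type*) [Field k] {n : ℕ} (a : Fin n → ℕ) : Ideal (MvPolynomial (Fin n) k) :=
  Ideal.span (Set.range fun i => X i ^ a i)

theorem powerIdeal_eq_ofList (a : Fin n → ℕ) (ρ : Equiv.Perm (Fin n)) :
    powerIdeal k a = Ideal.ofList (List.ofFn fun i => (X (ρ i) ^ a (ρ i) : S)) := by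
  rw [ofList_ofFn]
  exact congrArg Ideal.span (ρ.surjective.range_comp fun i => (X i ^ a i : S)).symm

theorem powerIdeal_eq_span_monomial (a : Fin n → ℕ) :
    powerIdeal k a = Ideal.span ((fun s => monomial s (1 : k)) ''
      Set.range fun i => Finsupp.single i (a i)) := by
  rw [powerIdeal, ← Set.range_comp]
  simp only [X_pow_eq_monomial, Function.comp_def]

theorem mem_powerIdeal {a : Fin n → ℕ} {x : S} :
    x ∈ powerIdeal k a ↔ ∀ m ∈ x.support, ∃ i, a i ≤ m i := by
  rw [powerIdeal_eq_span_monomial, mem_ideal_span_monomial_image]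
  simp [Finsupp.single_le_iff]

theorem degree_eq_of_mem_support {x : S} {d : ℕ} (hx : x.IsHomogeneous d) {m : Fin n →₀ ℕ}
    (hm : m ∈ x.support) : ∑ i, m i = d := by
  rw [← Finsupp.degree_eq_sum]
  by_contra h
  exact mem_support_iff.1 hm (hx.coeff_eq_zero h)

theorem mem_powerIdeal_of_lt {a : Fin n → ℕ} {x : S} {d : ℕ} (hx : x.IsHomogeneous d)
    (hd : ∑ i, (a i - 1) < d) : x ∈ powerIdeal k a := by
  rw [mem_powerIdeal]
  intro m hm
  by_contra! h
  have h1 := degree_eq_of_mem_support hx hm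
  have : ∑ i, m i ≤ ∑ i, (a i - 1) := Finset.sum_le_sum fun i _ => by have := h i; omega
  omega

theorem gradedDim_powerIdeal {a : Fin n → ℕ} (ha : ∀ i, 0 < a i) :
    gradedDim (powerIdeal k a) (∑ i, (a i - 1)) + 1 =
      gradedDim (⊤ : Ideal S) (∑ i, (a i - 1)) := by
  set σ := ∑ i, (a i - 1) with hσ
  -- The only monomial of degree `σ` outside the ideal.
  let m₀ : Fin n →₀ ℕ := Finsupp.equivFunOnFinite.symm fun i => a i - 1
  have hm₀ : ∀ i, m₀ i = a i - 1 := fun i => rfl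
  let ψ := (lcoeff k m₀).domRestrict (homogeneousSubmodule (Fin n) k σ)
  have hker : gradedPart (powerIdeal k a) σ =
      (LinearMap.ker ψ).map (homogeneousSubmodule (Fin n) k σ).subtype := by
    ext x
    have hiff : x.IsHomogeneous σ → (x ∈ powerIdeal k a ↔ coeff m₀ x = 0) := by
      intro hx
      rw [mem_powerIdeal]
      constructor
      · intro h
        by_contra h0
        obtain ⟨i, hi⟩ := h m₀ (mem_support_iff.2 h0)
        have := ha i
        rw [hm₀] at hi
        omega
      · intro h m hm
        by_contra! hlt
        have h1 := degree_eq_of_mem_support hx hm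
        have h2 : ∀ i ∈ Finset.univ, m i ≤ a i - 1 := fun i _ => by have := hlt i; omega
        have h3 := (Finset.sum_eq_sum_iff_of_le h2).1 (h1.trans hσ)
        have : m = m₀ := Finsupp.ext fun i => h3 i (Finset.mem_univ i)
        rw [this] at hm
        exact mem_support_iff.1 hm h
    simp only [mem_gradedPart, Submodule.mem_map, LinearMap.mem_ker, Submodule.subtype_apply,
      Subtype.exists, mem_homogeneousSubmodule, exists_and_right, exists_eq_right]
    constructor
    · rintro ⟨h1, h2⟩
      exact ⟨h2, (hiff h2).1 h1⟩
    · rintro ⟨h2, h1⟩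
      exact ⟨(hiff h2).2 h1, h2⟩
  have hsurj : Function.Surjective ψ := by
    intro c
    refine ⟨⟨monomial m₀ c, isHomogeneous_monomial _ ?_⟩, ?_⟩
    · rw [Finsupp.degree_eq_sum]
      exact Finset.sum_congr rfl fun i _ => hm₀ i
    · change coeff m₀ (monomial m₀ c) = c
      simp
  have h := LinearMap.finrank_range_add_finrank_ker ψ
  rw [LinearMap.range_eq_top.2 hsurj, finrank_top, Module.finrank_self] at h
  rw [gradedDim, gradedDim, gradedPart_top, hker, Submodule.finrank_map_subtype_eq, add_comm]
  exact h

/-! ### Gorenstein duality and Hilbert functions of links -/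

/-- `S / J` is a graded Artinian Gorenstein algebra with socle in degree `σ`. -/
structure IsGorenstein (J : Ideal (MvPolynomial (Fin n) k)) (σ : ℕ) : Prop where
  homog : Homog J
  socle : SocleConcentrated J σ
  gradedDim_socle : gradedDim J σ + 1 = gradedDim (⊤ : Ideal (MvPolynomial (Fin n) k)) σ
  mem_of_lt : ∀ (d : ℕ) (x : MvPolynomial (Fin n) k), σ < d → x.IsHomogeneous d → x ∈ J

theorem RegularMod.hilbertFunction_eq_powerIdeal {a : Fin n → ℕ} {f : Fin n → S}
    (hf : ∀ i, (f i).IsHomogeneous (a i)) (h : RegularMod ⊥ (List.ofFn f)) :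
    hilbertFunction (Ideal.span (Set.range f)) = hilbertFunction (powerIdeal k a) := by
  rw [← ofList_ofFn, powerIdeal_eq_ofList a (Equiv.refl _)]
  exact RegularMod.hilbertFunction_eq (forall₂_isHomogeneous_ofFn hf)
    (forall₂_isHomogeneous_ofFn fun i => isHomogeneous_X_pow i _) h
    (regularMod_X_pow (Equiv.refl _) a)

/-- The socle comes from the exchange argument; the two remaining dimension conditions are
transported from `powerIdeal k a`, which has the same Hilbert function. -/
theorem isGorenstein_of_regularMod [Infinite k] {a : Fin n → ℕ} (ha : ∀ i, 0 < a i)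
    {f : Fin n → S} (hf : ∀ i, (f i).IsHomogeneous (a i)) (h : RegularMod ⊥ (List.ofFn f)) :
    IsGorenstein (Ideal.span (Set.range f)) (∑ i, (a i - 1)) := by
  have hF := forall₂_isHomogeneous_ofFn hf
  have hH := h.hilbertFunction_eq_powerIdeal hf
  refine ⟨?_, ?_, ?_, ?_⟩
  · rw [← ofList_ofFn]
    exact homog_ofList hF
  · rw [← ofList_ofFn]
    refine socleConcentrated_append (L := []) hF ?_ (by simp) (by simp) h ?_
    · intro d hd
      obtain ⟨i, rfl⟩ := (List.mem_ofFn' _ _).1 hd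
      exact ha i
    · rw [List.length_ofFn, List.sum_ofFn]
      have : ∑ i, a i = ∑ i : Fin n, ((a i - 1) + 1) :=
        Finset.sum_congr rfl fun i _ => by have := ha i; omega
      rw [this, Finset.sum_add_distrib]
      simp
  · rw [gradedDim_eq_iff.2 (congrFun hH _)]
    exact gradedDim_powerIdeal ha
  · intro d x hd hx
    have h1 : gradedPart (powerIdeal k a) d = gradedPart ⊤ d :=
      le_antisymm (fun x hx => ⟨trivial, hx.2⟩) fun x hx => ⟨mem_powerIdeal_of_lt hx.2 hd, hx.2⟩
    have h2 : gradedPart (Ideal.span (Set.range f)) d = gradedPart ⊤ d := by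
      refine Submodule.eq_of_le_of_finrank_eq (fun x hx => ⟨trivial, hx.2⟩) ?_
      rw [← h1]
      exact gradedDim_eq_iff.2 (congrFun hH _)
    have h3 : x ∈ gradedPart ⊤ d := ⟨trivial, hx⟩
    rw [← h2] at h3
    exact h3.1

theorem isGorenstein_powerIdeal [Infinite k] {a : Fin n → ℕ} (ha : ∀ i, 0 < a i) :
    IsGorenstein (powerIdeal k a) (∑ i, (a i - 1)) :=
  isGorenstein_of_regularMod ha (fun i => isHomogeneous_X_pow i _)
    (regularMod_X_pow (Equiv.refl _) a)

namespace IsGorenstein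

variable {J : Ideal (MvPolynomial (Fin n) k)} {σ : ℕ}

/-- Below degree `σ` there is no socle, so some variable keeps `u` outside `J`; iterate up to degree
`σ`. -/
theorem exists_mul_notMem (hJ : IsGorenstein J σ) {m e : ℕ} (hem : e + m = σ) {u : S}
    (hu : u.IsHomogeneous e) (huJ : u ∉ J) : ∃ v : S, v.IsHomogeneous m ∧ u * v ∉ J := by
  induction m generalizing e u with
  | zero => exact ⟨1, isHomogeneous_one _ _, by simpa using huJ⟩
  | succ m ih =>
    have : ∃ i, X i * u ∉ J := by
      by_contra! h
      exact huJ (hJ.socle e u (by omega) hu h)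
    obtain ⟨i, hi⟩ := this
    obtain ⟨v, hv, huv⟩ := ih (e := 1 + e) (by omega) ((isHomogeneous_X k i).mul hu) hi
    refine ⟨X i * v, ?_, by rwa [← mul_assoc, mul_comm u]⟩
    rw [add_comm m]
    exact (isHomogeneous_X k i).mul hv

theorem exists_functional (hJ : IsGorenstein J σ) :
    ∃ φ : S →ₗ[k] k, ∀ x : S, x.IsHomogeneous σ → (φ x = 0 ↔ x ∈ J) := by
  have hle : gradedPart J σ ≤ gradedPart ⊤ σ := fun x hx => ⟨trivial, hx.2⟩
  have hdim := hJ.gradedDim_socle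
  have hne : gradedPart J σ ≠ gradedPart ⊤ σ := fun h => by
    rw [gradedDim, gradedDim, h] at hdim
    omega
  obtain ⟨x₀, hx₀, hx₀J⟩ := SetLike.exists_of_lt (lt_of_le_of_ne hle hne)
  obtain ⟨φ, hφ, hker⟩ := Submodule.exists_le_ker_of_notMem hx₀J
  refine ⟨φ, fun x hx => ⟨fun h0 => ?_, fun hxJ => hker ⟨hxJ, hx⟩⟩⟩
  by_contra hxJ
  -- A larger kernel would fit strictly between `J_σ` and `S_σ`, although `J_σ` has codimension one.
  have hlt : gradedPart J σ < gradedPart ⊤ σ ⊓ LinearMap.ker φ := by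
    refine lt_of_le_of_ne (le_inf hle hker) fun h => hxJ ?_
    have : x ∈ gradedPart J σ := by
      rw [h]
      exact ⟨⟨trivial, hx⟩, h0⟩
    exact this.1
  have hlt2 : gradedPart ⊤ σ ⊓ LinearMap.ker φ < gradedPart ⊤ σ := by
    refine lt_of_le_of_ne inf_le_left fun h => hφ ?_
    rw [← h] at hx₀
    exact hx₀.2
  have h1 := Submodule.finrank_lt_finrank_of_lt hlt2
  have : Module.Finite k ↥(gradedPart ⊤ σ ⊓ LinearMap.ker φ) :=
    Submodule.finiteDimensional_of_le hlt2.le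
  have h2 := Submodule.finrank_lt_finrank_of_lt hlt
  rw [gradedDim, gradedDim] at hdim
  omega

theorem mem_colon_iff (hJ : IsGorenstein J σ) {φ : S →ₗ[k] k}
    (hφ : ∀ x : S, x.IsHomogeneous σ → (φ x = 0 ↔ x ∈ J)) {I : Ideal S} (hI : Homog I)
    {c d : ℕ} (hcd : d + c = σ) {u : S} (hu : u.IsHomogeneous d) :
    u ∈ J.colon (I : Set S) ↔ ∀ v ∈ gradedPart I c, φ (u * v) = 0 := by
  rw [Submodule.mem_colon]
  constructor
  · intro h v hv
    exact (hφ _ (hcd ▸ hu.mul hv.2)).2 (h v hv.1)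
  · intro h w hw
    rw [smul_eq_mul, ← sum_homogeneousComponent w, Finset.mul_sum]
    refine sum_mem fun e _ => ?_
    have hwe : homogeneousComponent e w ∈ I := homogeneousComponent_mem_of_mem hI hw e
    have hwe' := homogeneousComponent_isHomogeneous e w
    obtain hlt | hle := lt_or_ge c e
    · exact hJ.mem_of_lt (d + e) _ (by omega) (hu.mul hwe')
    -- A nonzero product in degree at most `σ` can be multiplied up to degree `σ` without entering
    -- `J`, so testing against `I_c` alone suffices.
    · by_contra hnot
      obtain ⟨v, hv, hnv⟩ := hJ.exists_mul_notMem (m := c - e) (by omega) (hu.mul hwe') hnot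
      rw [mul_assoc] at hnv
      have hwv := hwe'.mul hv
      rw [show e + (c - e) = c by omega] at hwv
      exact hnv ((hφ _ (hcd ▸ hu.mul hwv)).1 (h _ ⟨I.mul_mem_right _ hwe, hwv⟩))

/-- The Hilbert function of a link. -/
theorem gradedDim_colon (hJ : IsGorenstein J σ) {I : Ideal S} (hI : Homog I) (hJI : J ≤ I)
    {c d : ℕ} (hcd : d + c = σ) :
    gradedDim (J.colon (I : Set S)) d + gradedDim I c = gradedDim (⊤ : Ideal S) d + gradedDim J c := by
  obtain ⟨φ, hφ⟩ := hJ.exists_functional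
  -- The left kernel of this pairing is `(J : I)_d` and the right kernel is `J_c`; the formula is
  -- the equality of its two ranks.
  let B : gradedPart (⊤ : Ideal S) d →ₗ[k] gradedPart I c →ₗ[k] k :=
    (((LinearMap.mul k S).compr₂ φ).domRestrict₁₂ (gradedPart ⊤ d) (gradedPart I c))
  have hB : ∀ u v, B u v = φ (u * v) := fun u v => rfl
  have hk1 : gradedPart (J.colon (I : Set S)) d =
      (LinearMap.ker B).map (gradedPart (⊤ : Ideal S) d).subtype := by
    ext x
    simp only [Submodule.mem_map, LinearMap.mem_ker, Submodule.subtype_apply, Subtype.exists,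
      exists_and_right, exists_eq_right, LinearMap.ext_iff, hB, LinearMap.zero_apply,
      Subtype.forall]
    constructor
    · rintro ⟨h1, h2⟩
      exact ⟨⟨trivial, h2⟩, (hJ.mem_colon_iff hφ hI hcd h2).1 h1⟩
    · rintro ⟨⟨-, h2⟩, h1⟩
      exact ⟨(hJ.mem_colon_iff hφ hI hcd h2).2 h1, h2⟩
  have hk2 : gradedPart J c = (LinearMap.ker B.flip).map (gradedPart I c).subtype := by
    have htop : Homog (⊤ : Ideal S) := Ideal.IsHomogeneous.top _
    have hJtop : J.colon ((⊤ : Ideal S) : Set S) = J := by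
      rw [Submodule.top_coe, Submodule.colon_univ]
    ext x
    simp only [Submodule.mem_map, LinearMap.mem_ker, Submodule.subtype_apply, Subtype.exists,
      exists_and_right, exists_eq_right, LinearMap.ext_iff, hB, LinearMap.zero_apply,
      Subtype.forall, LinearMap.flip_apply]
    constructor
    · rintro ⟨h1, h2⟩
      refine ⟨⟨hJI h1, h2⟩, fun u hu => ?_⟩
      exact (hφ _ (hcd ▸ hu.2.mul h2)).2 (J.mul_mem_left _ h1)
    · rintro ⟨⟨-, h2⟩, h1⟩
      refine ⟨?_, h2⟩
      have := (hJ.mem_colon_iff hφ htop (by omega : c + d = σ) h2).2 fun v hv => by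
        rw [mul_comm]
        exact h1 v hv
      rwa [hJtop] at this
  have hr1 := LinearMap.finrank_range_add_finrank_ker B
  have hr2 := LinearMap.finrank_range_add_finrank_ker B.flip
  have hflip : Module.finrank k (LinearMap.range B.flip) = Module.finrank k (LinearMap.range B) := by
    rw [← LinearMap.finrank_range_dualMap_eq_finrank_range B]
    have : B.flip = B.dualMap ∘ₗ (Module.evalEquiv k (gradedPart I c)).toLinearMap := rfl
    rw [this, LinearMap.range_comp, LinearEquiv.range, Submodule.map_top]
  rw [gradedDim, gradedDim, gradedDim, gradedDim, hk1, hk2, Submodule.finrank_map_subtype_eq,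
    Submodule.finrank_map_subtype_eq]
  omega

theorem hilbertFunction_colon_eq (hJ : IsGorenstein J σ) {J' : Ideal S} (hJ' : IsGorenstein J' σ)
    {I I' : Ideal S} (hI : Homog I) (hI' : Homog I') (hJI : J ≤ I) (hJI' : J' ≤ I')
    (hJH : hilbertFunction J = hilbertFunction J') (hIH : hilbertFunction I = hilbertFunction I') :
    hilbertFunction (J.colon (I : Set S)) = hilbertFunction (J'.colon (I' : Set S)) := by
  funext d
  rw [← gradedDim_eq_iff]
  obtain hlt | hle := lt_or_ge σ d
  · have : ∀ {K L : Ideal S}, IsGorenstein K σ →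
        gradedPart (K.colon (L : Set S)) d = gradedPart ⊤ d := fun hK =>
      le_antisymm (fun x hx => ⟨trivial, hx.2⟩) fun x hx =>
        ⟨Ideal.le_colon (hK.mem_of_lt d x hlt hx.2), hx.2⟩
    rw [gradedDim, gradedDim, this hJ, this hJ']
  · obtain ⟨c, rfl⟩ := Nat.exists_eq_add_of_le hle
    have h1 := hJ.gradedDim_colon hI hJI rfl
    have h2 := hJ'.gradedDim_colon hI' hJI' rfl
    rw [gradedDim_eq_iff.2 (congrFun hJH c), gradedDim_eq_iff.2 (congrFun hIH c)] at h1
    omega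

end IsGorenstein

/-! ### Monomial ideals and the imitation of a link sequence -/

theorem isMonomialIdeal_of_forall {J : Ideal S}
    (h : ∀ x ∈ J, ∀ m ∈ x.support, monomial m (1 : k) ∈ J) : IsMonomialIdeal J := by
  refine ⟨{m | monomial m (1 : k) ∈ J}, le_antisymm (fun x hx => ?_) (Ideal.span_le.2 ?_)⟩
  · rw [mem_ideal_span_monomial_image]
    exact fun m hm => ⟨m, h x hx m hm, le_rfl⟩
  · rintro _ ⟨m, hm, rfl⟩
    exact hm

theorem IsMonomialIdeal.monomial_mem {J : Ideal S} (hJ : IsMonomialIdeal J) {x : S} (hx : x ∈ J)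
    {m : Fin n →₀ ℕ} (hm : m ∈ x.support) : monomial m (1 : k) ∈ J := by
  obtain ⟨A, rfl⟩ := hJ
  rw [mem_ideal_span_monomial_image] at hx ⊢
  intro m' hm'
  obtain rfl := Finset.mem_singleton.1 (support_monomial_subset hm')
  exact hx _ hm

theorem isMonomialIdeal_powerIdeal (a : Fin n → ℕ) : IsMonomialIdeal (powerIdeal k a) :=
  ⟨_, powerIdeal_eq_span_monomial a⟩

theorem IsMonomialIdeal.homog {J : Ideal S} (hJ : IsMonomialIdeal J) : Homog J := by
  obtain ⟨A, rfl⟩ := hJ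
  refine Ideal.homogeneous_span _ _ ?_
  rintro _ ⟨m, -, rfl⟩
  exact ⟨_, isHomogeneous_monomial _ rfl⟩

/-- Multiplying by a monomial generator of `I` causes no cancellation among the terms of `x`, so
each term of `x` lies in the colon separately. -/
theorem IsMonomialIdeal.colon {J I : Ideal S} (hJ : IsMonomialIdeal J) (hI : IsMonomialIdeal I) :
    IsMonomialIdeal (J.colon (I : Set S)) := by
  refine isMonomialIdeal_of_forall fun x hx m hm => ?_
  obtain ⟨A, rfl⟩ := hI
  have hle : Ideal.span ((fun α => monomial α (1 : k)) '' A) ≤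
      J.colon ({monomial m (1 : k)} : Set S) := by
    refine Ideal.span_le.2 ?_
    rintro _ ⟨γ, hγ, rfl⟩
    have h1 := Submodule.mem_colon.1 hx _ (Ideal.subset_span ⟨γ, hγ, rfl⟩)
    have h2 : γ + m ∈ (x • monomial γ (1 : k)).support := by
      rw [smul_eq_mul, mul_comm, mem_support_iff, coeff_monomial_mul, one_mul]
      exact mem_support_iff.1 hm
    have h3 := hJ.monomial_mem h1 h2
    rw [SetLike.mem_coe, Submodule.mem_colon_singleton, smul_eq_mul, monomial_mul, one_mul]
    exact h3
  refine Submodule.mem_colon.2 fun y hy => ?_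
  have := Submodule.mem_colon_singleton.1 (hle hy)
  rwa [smul_eq_mul, mul_comm] at this

theorem ne_top_of_hilbertFunction_eq {I J : Ideal S} (h : hilbertFunction I = hilbertFunction J)
    (hI : I ≠ ⊤) : J ≠ ⊤ := by
  rintro rfl
  apply hI
  have h1 := gradedDim_eq_iff.2 (congrFun h 0)
  have h2 : gradedPart I 0 = gradedPart ⊤ 0 :=
    Submodule.eq_of_le_of_finrank_eq (fun x hx => ⟨trivial, hx.2⟩) h1
  have h3 : (1 : S) ∈ gradedPart ⊤ 0 := ⟨trivial, isHomogeneous_one _ _⟩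
  rw [← h2] at h3
  exact (Ideal.eq_top_iff_one I).2 h3.1

theorem powerIdeal_le {a : Fin n → ℕ} {I : Ideal S} :
    powerIdeal k a ≤ I ↔ ∀ i, X i ^ a i ∈ I := by
  rw [powerIdeal, Ideal.span_le, Set.range_subset_iff]
  rfl

theorem powerIdeal_anti {a b : Fin n → ℕ} (h : a ≤ b) : powerIdeal k b ≤ powerIdeal k a :=
  powerIdeal_le.2 fun i => Ideal.pow_mem_of_pow_mem _ (powerIdeal_le.1 le_rfl i) (h i)

/-- The monomial ideals that follow a link sequence. -/
theorem IsBoundedLinkSequence.exists_monomial [Infinite k] {I : Ideal S} {s : ℕ}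
    {L : Fin (s + 1) → Ideal S} {J : Fin s → Ideal S} {a : Fin s → Fin n → ℕ}
    (h : IsBoundedLinkSequence I n s L J a) (i : Fin (s + 1)) :
    ∃ M : Ideal S, IsMonomialIdeal M ∧ hilbertFunction (L i) = hilbertFunction M ∧
      ∀ t : Fin s, (t : ℕ) ≤ i → powerIdeal k (a t) ≤ M := by
  induction i using Fin.reverseInduction with
  | last =>
    obtain ⟨r, c, g, hg, hL⟩ := h.last
    obtain ⟨t₀, ht₀⟩ : ∃ t₀ : Fin s, (t₀ : ℕ) + 1 = s :=
      ⟨⟨s - 1, Nat.sub_lt h.pos one_pos⟩, Nat.sub_add_cancel h.pos⟩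
    have hsucc : t₀.succ = Fin.last s := Fin.ext (by simpa using ht₀)
    have hlink := h.linked t₀
    rw [hsucc] at hlink
    have hr : r = n := by
      have h1 := hlink.height_right
      rw [hL, hg.height_eq] at h1
      exact_mod_cast h1
    subst hr
    -- The degrees given by `IsCI` are unordered, while the degree comparison needs them sorted.
    let τ := Tuple.sort c
    have hcm : Monotone (c ∘ τ) := Tuple.monotone_sort c
    obtain ⟨ham, f, hf, hJf⟩ := h.type t₀
    have hspan : Ideal.span (Set.range (g ∘ τ)) = L (Fin.last s) := by
      rw [hL, τ.surjective.range_comp]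
    have hle : c ∘ τ ≤ a t₀ := by
      refine hf.degree_le (g := g ∘ τ) (fun i => hg.1 (τ i)) ?_ ham hcm ?_
      · rw [hspan]
        exact hlink.right.2
      · rw [hspan, ← hJf]
        exact hlink.le.trans inf_le_right
    refine ⟨powerIdeal k (c ∘ τ), isMonomialIdeal_powerIdeal _, ?_, fun t _ => ?_⟩
    · rw [hL, ← ofList_ofFn, powerIdeal_eq_ofList _ τ.symm]
      simp only [Function.comp_apply, Equiv.apply_symm_apply]
      exact RegularMod.hilbertFunction_eq (forall₂_isHomogeneous_ofFn hg.1)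
        (forall₂_isHomogeneous_ofFn fun i => isHomogeneous_X_pow _ _) hg.regularMod
        (regularMod_X_pow τ.symm c)
    · refine powerIdeal_anti (hle.trans (h.antitone ?_))
      rw [Fin.le_def]
      omega
  | cast i ih =>
    obtain ⟨M, hM, hH, hle⟩ := ih
    obtain ⟨-, f, hf, hJf⟩ := h.type i
    have hlink := h.linked i
    have hpos := hf.degree_pos
    -- Carrying the containment for all `t` up to the current index makes it available for the link
    -- `i` itself.
    have hMi : powerIdeal k (a i) ≤ M := hle i (by simp)
    refine ⟨(powerIdeal k (a i)).colon (M : Set S), (isMonomialIdeal_powerIdeal _).colon hM, ?_,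
      fun t ht => (powerIdeal_anti (h.antitone ?_)).trans Ideal.le_colon⟩
    · rw [hlink.left_eq, hJf]
      refine (isGorenstein_of_regularMod hpos hf.1 hf.regularMod).hilbertFunction_colon_eq
        (isGorenstein_powerIdeal hpos) hlink.right.1 hM.homog ?_ hMi
        (hf.regularMod.hilbertFunction_eq_powerIdeal hf.1) hH
      rw [← hJf]
      exact hlink.le.trans inf_le_right
    · rw [Fin.le_def]
      simpa using ht

end Liaison

end

theorem theorem3p2 {k : Type*} [Field k] [Infinite k] {n : ℕ} (e : Fin n → ℕ)
    (he2 : ∀ i, 2 ≤ e i) (hemono : Monotone e)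
    (I : Ideal (MvPolynomial (Fin n) k)) (hI : Liaison.IsHomogeneousProper I)
    (hmin : Liaison.MinimallyContainsRegularSeq I e)
    (hlicci : Liaison.IsSeqBoundedLicciWithMinimalFirstLink I) :
    ∃ J : Ideal (MvPolynomial (Fin n) k),
      Liaison.IsMonomialIdeal J ∧ J ≠ ⊤ ∧
      (∀ i, (MvPolynomial.X i : MvPolynomial (Fin n) k) ^ e i ∈ J) ∧
      Liaison.hilbertFunction I = Liaison.hilbertFunction J := by
  obtain ⟨r, s, L, J, a, h, -, b, hb, hJb⟩ := hlicci
  have hstart : L (Fin.castSucc ⟨0, h.pos⟩) = I := h.start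
  rw [hstart] at hb
  obtain rfl : r = n := by
    have := hb.2.1.symm.trans hmin.2.1
    exact_mod_cast this
  obtain rfl := hb.unique hmin
  obtain ⟨hbm, g, hg, hJg⟩ := hJb
  obtain ⟨ham, f, hf, hJf⟩ := h.type ⟨0, h.pos⟩
  -- The first linking ideal has both types `a 0` and `b`; only this inequality between them is
  -- needed.
  have hle : a ⟨0, h.pos⟩ ≤ b := hg.degree_le hf.1 hf.span_ne_top hbm ham (hJg ▸ hJf).le
  obtain ⟨M, hM, hH, hM'⟩ := h.exists_monomial 0
  rw [h.start] at hH
  exact ⟨M, hM, Liaison.ne_top_of_hilbertFunction_eq hH hI.2,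
    Liaison.powerIdeal_le.1 ((Liaison.powerIdeal_anti hle).trans (hM' ⟨0, h.pos⟩ le_rfl)), hH⟩
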